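/- \textbf{Square Separation Theorem.} Throughout, a \emph{square} is an open square in $\mathbb R^2$ of positive side length whose sides are parallel to the coordinate axes. Let $\Omega\subset\mathbb R^2$ be a bounded simply connected domain (a bounded, open, connected and simply connected set), and let $S\subset\Omega$ be a square such that $\partial S\cap\partial\Omega\neq\emptyset$. Let $B\in\Omega\setminus\overline S$. Then there exists a square $Q\subset\Omega\setminus\overline S$ satisfying the following two conditions: (i) $\overline Q\cap\overline S\cap\Omega\neq\emptyset$; (ii) either $B\in\overline Q$, or $S$ and $B$ lie in different connected components of $\Omega\setminus\overline Q$ (that is, $S$ is contained in one connected component of $\Omega\setminus\overline Q$, and $B$ belongs to another one). -/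

import Mathlib

/-- The open square in the plane with sides parallel to the coordinate axes, centre `c` and side
length `2 * r`. -/
def axisSquare (c : ℝ × ℝ) (r : ℝ) : Set (ℝ × ℝ) :=
  {z | |z.1 - c.1| < r ∧ |z.2 - c.2| < r}

/-- `S` is a (nondegenerate) open square with sides parallel to the coordinate axes. -/
def IsAxisSquare (S : Set (ℝ × ℝ)) : Prop :=
  ∃ (c : ℝ × ℝ) (r : ℝ), 0 < r ∧ S = axisSquare c r

/-- The set `S` and the point `b` lie in different connected components of (the subspace) `U`:
`S` is contained in one component, `b` belongs to another one. -/
def LieInDifferentComponents {X : Type*} [TopologicalSpace X] (U S : Set X) (b : X) : Prop :=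
  ∃ x ∈ U, ∃ y ∈ U, S ⊆ connectedComponentIn U x ∧ b ∈ connectedComponentIn U y ∧
    connectedComponentIn U x ≠ connectedComponentIn U y

/-!
Write `S = ball c ‖d‖` for the sup norm, where `c - d` is a point of `∂S` outside `Ω`, and
parametrize `∂S` by the angle `θ ∈ [-π, π]` of the radius from `c`, so that `θ = ±π` is the point
`c - d`. At each `θ` the squares of radius `r` that touch `S` at the point of angle `θ`, with centre
on the radius through it, increase with `r`; those that do not meet the complement of `Ω`
have a greatest member `Q θ`, which has a point outside `Ω` in its closure. If the point of angle
`θ` lies in `Ω`, then `Q θ` is a candidate for the required square, and if it fails, then `B` can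
be joined in `Ω \ (S ∪ closure (Q θ))` to a point of `∂S` of some angle `θ' ≠ θ`.

The topological input is `not_isPreconnected_across_square`: a crosscut that runs from `c - d`
along two radii to the point of angle `φ` and on to a point outside `Ω` separates, in `Ω`, the
boundary points of angle less than `φ` from those of angle greater than `φ`. For points `a`, `b`
outside the simply connected set `Ω`, the functions `z - a` and `z - b` have continuous logarithms
on `Ω`; on the complement of the crosscut, `(z - b) / (z - a)` also has a logarithm which is a sum
of principal logarithms. The difference of the two is locally constant off the crosscut and jumps
by `2 π i` across it at `c`. In particular `θ' < θ` and `θ' > θ` cannot both occur for the same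
`θ` (`LinkedAvoiding.false_of_lt_of_lt`).

Suppose every `Q θ` fails, and let `(α, β)` be a maximal interval of angles of points of
`∂S ∩ Ω`, one of which, `θ₀`, is joined to `B` by a continuum `V₀` outside `S`. The conditions
"some `θ' < θ` occurs" and "some `θ' > θ` occurs" are open (`isClosed_hitAngles`), disjoint, and
cover `(α, β)`, so one of them holds throughout, say the first. Let `θ` approach `α`. If `Q θ`
avoids `V₀`, then `θ₀ > θ` occurs as well, which is impossible. Otherwise `Q θ` is not small and
hence its closure covers the part of `∂S` between `α` and `θ` (`eventually_touchPoint_not_mem`);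
so `θ' < α`, and then `θ'` and `θ₀` are joined across the crosscut ending at the point of angle
`α`, which lies outside `Ω`.
-/

open Complex Filter Topology Metric Set

/-! ### Logarithms and crosscuts -/

theorem sub_div_sub_mem_slitPlane {z p q : ℂ} (h : z ∉ segment ℝ p q) :
    (z - p) / (z - q) ∈ slitPlane := by
  have hq : z - q ≠ 0 := fun h0 ↦ h (by rw [sub_eq_zero.1 h0]; exact right_mem_segment ℝ p q)
  by_contra hn
  rw [mem_slitPlane_iff, not_or, not_lt, not_not] at hn
  obtain ⟨hre, him⟩ := hn
  set t : ℝ := -((z - p) / (z - q)).re with ht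
  have ht0 : 0 ≤ t := by linarith
  have hw : (z - p) / (z - q) = -(t : ℂ) := by
    apply Complex.ext <;> simp [ht, him]
  rw [div_eq_iff hq] at hw
  have h1 : (1 + (t : ℂ)) ≠ 0 := by
    have : (1 + t : ℝ) ≠ 0 := by positivity
    exact_mod_cast this
  refine h ⟨1 / (1 + t), t / (1 + t), by positivity, by positivity, ?_, ?_⟩
  · field_simp
  · simp only [real_smul]
    push_cast
    field_simp
    linear_combination -hw

/-- The sum of the two principal logarithms whose cuts are the radii of angles `π` and `φ`,
evaluated at the end of the radius of angle `θ` at distance `t` from the vertex; the terms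
`± log t` have been cancelled. -/
noncomputable def radialLog (σ φ θ t : ℝ) : ℂ :=
  log ((1 + t * exp (θ * I)) * exp (-(θ * I))) +
    log (exp (θ * I) / (t * exp (θ * I) - σ * exp (φ * I)))

/-- At the point at distance `t` on the radius of angle `θ` (all radii measured in units of `d`), the
two principal logarithms cut along the radii of angles `π` and `φ` add up to `radialLog`: the
singular terms at the vertex cancel. -/
theorem log_add_log_eq_radialLog {d : ℂ} (hd : d ≠ 0) {σ φ θ t : ℝ} (ht : 0 < t)
    (h1 : 1 + t * exp (θ * I) ≠ 0) (h2 : t * exp (θ * I) - σ * exp (φ * I) ≠ 0) :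
    log ((t * (d * exp (θ * I)) + d) / (t * (d * exp (θ * I)))) +
      log ((t * (d * exp (θ * I))) / (t * (d * exp (θ * I)) - σ * (d * exp (φ * I)))) =
    radialLog σ φ θ t := by
  have hθ := exp_ne_zero (θ * I)
  have ht' : (t : ℂ) ≠ 0 := by exact_mod_cast ht.ne'
  have e1 : (t * (d * exp (θ * I)) + d) / (t * (d * exp (θ * I))) =
      ((t⁻¹ : ℝ) : ℂ) * ((1 + t * exp (θ * I)) * exp (-(θ * I))) := by
    rw [exp_neg]; push_cast; field_simp; ring
  have h3 : t * (d * exp (θ * I)) - σ * (d * exp (φ * I)) ≠ 0 := by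
    rw [show t * (d * exp (θ * I)) - σ * (d * exp (φ * I)) =
      d * (t * exp (θ * I) - σ * exp (φ * I)) by ring]
    exact mul_ne_zero hd h2
  have e2 : (t * (d * exp (θ * I))) / (t * (d * exp (θ * I)) - σ * (d * exp (φ * I))) =
      (t : ℂ) * (exp (θ * I) / (t * exp (θ * I) - σ * exp (φ * I))) := by
    rw [div_eq_iff h3]; field_simp [h2]
    rw [mul_comm (φ : ℂ) I] at h2
    exact (div_self h2).symm
  rw [e1, e2, log_ofReal_mul (inv_pos.2 ht) (mul_ne_zero h1 (exp_ne_zero _)),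
    log_ofReal_mul ht (div_ne_zero hθ h2), Real.log_inv, radialLog]
  push_cast
  ring

theorem log_exp_sub_angle {σ φ θ k : ℝ} (hσ : 0 < σ) (hk : exp (k * I) = -1)
    (h1 : -Real.pi < θ - φ + k) (h2 : θ - φ + k < Real.pi) :
    exp (θ * I) / (((0 : ℝ) : ℂ) * exp (θ * I) - σ * exp (φ * I)) ∈ slitPlane ∧
    log (exp (θ * I) / (((0 : ℝ) : ℂ) * exp (θ * I) - σ * exp (φ * I))) =
      -(Real.log σ : ℂ) + (θ - φ + k : ℝ) * I := by
  have e : exp (θ * I) / (((0 : ℝ) : ℂ) * exp (θ * I) - σ * exp (φ * I)) =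
      exp (-(Real.log σ : ℂ) + (θ - φ + k : ℝ) * I) := by
    have : exp (Real.log σ : ℂ) = σ := by rw [← ofReal_exp, Real.exp_log hσ]
    have hσ' : (σ : ℂ) ≠ 0 := by exact_mod_cast hσ.ne'
    have := exp_ne_zero (φ * I)
    rw [exp_add, exp_neg, ‹exp (Real.log σ : ℂ) = σ›]
    push_cast
    rw [add_mul, sub_mul, exp_add, exp_sub, hk]
    field_simp
    ring
  have hlog : log (exp (-(Real.log σ : ℂ) + (θ - φ + k : ℝ) * I)) =
      -(Real.log σ : ℂ) + (θ - φ + k : ℝ) * I := by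
    apply log_exp
    · rw [add_im, neg_im, ofReal_im, im_ofReal_mul]; simpa using h1
    · rw [add_im, neg_im, ofReal_im, im_ofReal_mul]; simpa using h2.le
  rw [e]
  refine ⟨?_, hlog⟩
  rw [mem_slitPlane_iff_arg]
  refine ⟨?_, exp_ne_zero _⟩
  rw [← log_im, hlog, add_im, neg_im, ofReal_im, im_ofReal_mul]
  simpa using h2.ne

/-- The limit value at the vertex. The angle `k` is `π` for `θ < φ` and `-π` for `θ > φ`, which gives
the jump by `2 π i` across the crosscut. -/
theorem radialLog_zero_and_continuousAt {σ φ θ k : ℝ} (hσ : 0 < σ) (hk : exp (k * I) = -1)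
    (h1 : -Real.pi < θ - φ + k) (h2 : θ - φ + k < Real.pi)
    (hθ1 : -Real.pi < θ) (hθ2 : θ < Real.pi) :
    radialLog σ φ θ 0 = -(Real.log σ : ℂ) + (k - φ : ℝ) * I ∧
      ContinuousAt (radialLog σ φ θ) 0 := by
  obtain ⟨hs, hl⟩ := log_exp_sub_angle hσ hk h1 h2
  have hl0 : log (exp (-(θ * I))) = -(θ * I) := by
    apply log_exp <;> simp <;> linarith
  have hs0 : (1 + ((0 : ℝ) : ℂ) * exp (θ * I)) * exp (-(θ * I)) ∈ slitPlane := by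
    rw [mem_slitPlane_iff_arg]
    have : (1 + ((0 : ℝ) : ℂ) * exp (θ * I)) * exp (-(θ * I)) = exp (-(θ * I)) := by simp
    rw [this]
    refine ⟨?_, exp_ne_zero _⟩
    rw [← log_im, hl0]
    simp; intro h; linarith
  constructor
  · rw [radialLog, hl]
    simp only [ofReal_zero, zero_mul, add_zero, one_mul, hl0]
    push_cast; ring
  · unfold radialLog
    refine ContinuousAt.add (ContinuousAt.clog ?_ hs0) (ContinuousAt.clog ?_ hs)
    · fun_prop
    · refine ContinuousAt.div (by fun_prop) (by fun_prop) ?_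
      intro h0
      rw [h0, div_zero] at hs
      exact zero_notMem_slitPlane hs

theorem IsPreconnected.im_eq_of_exp_eq_one {X : Type*} [TopologicalSpace X] {W : Set X}
    (hW : IsPreconnected W) {H : X → ℂ} (hH : ContinuousOn H W)
    (h : ∀ z ∈ W, exp (H z) = 1) {x y : X} (hx : x ∈ W) (hy : y ∈ W) : (H x).im = (H y).im := by
  have hT : IsDiscrete (range ((↑) : ℤ → ℝ)) := by
    rw [isDiscrete_iff_discreteTopology]
    exact Int.isClosedEmbedding_coe_real.isEmbedding.toHomeomorph.symm.isEmbedding.discreteTopology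
  have hc : ContinuousOn (fun z ↦ (H z).im / (2 * Real.pi)) W :=
    (continuous_im.comp_continuousOn hH).div_const _
  have := hW.constant_of_mapsTo hT hc (fun z hz ↦ ?_) hx hy
  · have hp := Real.pi_pos
    field_simp at this
    exact this
  · obtain ⟨n, hn⟩ := exp_eq_one_iff.1 (h z hz)
    refine ⟨n, ?_⟩
    simp only [hn]
    have : ((n : ℂ) * (2 * Real.pi * I)).im = n * (2 * Real.pi) := by simp
    rw [this]
    have hp := Real.pi_pos
    field_simp

/-- A crosscut `[c - d, c] ∪ [c, s] ∪ [s, a]` of a simply connected open set `U`, with both ends outside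
`U`, separates in `U` the two sides of its vertex `c`. -/
theorem not_isPreconnected_across_crosscut {U : Set ℂ} (hU : IsSimplyConnected U)
    (hUo : IsOpen U) {a c d : ℂ} {σ φ θ₁ θ₂ : ℝ} (hd : d ≠ 0) (hσ : 0 < σ)
    (hθ₁ : -Real.pi < θ₁) (h₁ : θ₁ < φ) (h₂ : φ < θ₂) (hθ₂ : θ₂ < Real.pi)
    (hc : c ∈ U) (hb : c - d ∉ U) (ha : a ∉ U)
    (hca : c ∉ segment ℝ (c + σ * (d * exp (φ * I))) a)
    {W : Set ℂ} (hWU : W ⊆ U)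
    (hWb : ∀ z ∈ W, z ∉ segment ℝ (c - d) c)
    (hWs : ∀ z ∈ W, z ∉ segment ℝ c (c + σ * (d * exp (φ * I))))
    (hWa : ∀ z ∈ W, z ∉ segment ℝ (c + σ * (d * exp (φ * I))) a)
    (hW₁ : ∀ᶠ t : ℝ in 𝓝[>] 0, c + t * (d * exp (θ₁ * I)) ∈ W)
    (hW₂ : ∀ᶠ t : ℝ in 𝓝[>] 0, c + t * (d * exp (θ₂ * I)) ∈ W) :
    ¬ IsPreconnected W := by
  intro hW
  set s := c + σ * (d * exp (φ * I)) with hs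
  have branch (p : ℂ) (hp : p ∉ U) : ∃ f : ℂ → ℂ, ContinuousOn f U ∧
      EqOn (exp ∘ f) (fun z ↦ z - p) U :=
    exists_continuousOn_eqOn_exp_comp hU hUo (by fun_prop)
      (by rintro ⟨z, hz, h0⟩; exact hp (by rwa [← sub_eq_zero.1 h0]))
  obtain ⟨Lb, hLb, hLb'⟩ := branch _ hb
  obtain ⟨La, hLa, hLa'⟩ := branch _ ha
  -- A difference of two branches of `log ((z - b) / (z - a))`, `b = c - d`, hence locally constant.
  set H : ℂ → ℂ := fun z ↦ Lb z - La z - log ((z - s) / (z - a)) -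
    (log ((z - (c - d)) / (z - c)) + log ((z - c) / (z - s))) with hH
  have ne_of {p q z : ℂ} (h : z ∉ segment ℝ p q) : z - p ≠ 0 ∧ z - q ≠ 0 := by
    constructor <;> intro h0 <;> rw [sub_eq_zero] at h0 <;> subst h0
    · exact h (left_mem_segment ℝ _ _)
    · exact h (right_mem_segment ℝ _ _)
  have clog {p q : ℂ} (h : ∀ z ∈ W, z ∉ segment ℝ p q) :
      ContinuousOn (fun z ↦ log ((z - p) / (z - q))) W :=
    ContinuousOn.clog (ContinuousOn.div (by fun_prop) (by fun_prop) fun z hz ↦ (ne_of (h z hz)).2)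
      fun z hz ↦ sub_div_sub_mem_slitPlane (h z hz)
  have hHc : ContinuousOn H W :=
    (((hLb.mono hWU).sub (hLa.mono hWU)).sub (clog hWa)).sub ((clog hWb).add (clog hWs))
  have hH1 : ∀ z ∈ W, exp (H z) = 1 := by
    intro z hz
    have e1 : exp (Lb z) = z - (c - d) := hLb' (hWU hz)
    have e2 : exp (La z) = z - a := hLa' (hWU hz)
    obtain ⟨n1, n2⟩ := ne_of (hWb z hz)
    obtain ⟨_, n3⟩ := ne_of (hWs z hz)
    obtain ⟨_, n4⟩ := ne_of (hWa z hz)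
    simp only [hH]
    rw [exp_sub, exp_sub, exp_sub, exp_add, e1, e2, exp_log (div_ne_zero n3 n4),
      exp_log (div_ne_zero n1 n2), exp_log (div_ne_zero n2 n3)]
    field_simp
  -- Along a radius from `c`, `H` extends continuously to the vertex `c` of the crosscut.
  have radial (θ k : ℝ) (hk : exp (k * I) = -1) (h1 : -Real.pi < θ - φ + k)
      (h2 : θ - φ + k < Real.pi) (hθ1 : -Real.pi < θ) (hθ2 : θ < Real.pi) :
      Tendsto (fun t : ℝ ↦ (H (c + t * (d * exp (θ * I)))).im) (𝓝[>] 0)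
        (𝓝 (Lb c - La c - log ((c - s) / (c - a)) -
          (-(Real.log σ : ℂ) + (k - φ : ℝ) * I)).im) := by
    obtain ⟨hr0, hrc⟩ := radialLog_zero_and_continuousAt hσ hk h1 h2 hθ1 hθ2
    have hz : ContinuousAt (fun t : ℝ ↦ c + t * (d * exp (θ * I))) 0 := by fun_prop
    have hz0 : c + ((0 : ℝ) : ℂ) * (d * exp (θ * I)) = c := by simp
    have hF : ContinuousAt (fun z ↦ Lb z - La z - log ((z - s) / (z - a))) c := by
      refine ((hLb.continuousAt (hUo.mem_nhds hc)).sub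
        (hLa.continuousAt (hUo.mem_nhds hc))).sub (ContinuousAt.clog ?_ ?_)
      · exact ContinuousAt.div (by fun_prop) (by fun_prop) (ne_of hca).2
      · exact sub_div_sub_mem_slitPlane hca
    have hcomp : ContinuousAt ((fun z ↦ Lb z - La z - log ((z - s) / (z - a))) ∘
        fun t : ℝ ↦ c + t * (d * exp (θ * I))) 0 :=
      ContinuousAt.comp (by rw [hz0]; exact hF) hz
    have hcont := hcomp.sub hrc
    have hlim := (continuous_im.continuousAt.tendsto.comp hcont.tendsto).mono_left
      (nhdsWithin_le_nhds (s := Ioi (0 : ℝ)))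
    simp only [Pi.sub_apply, Function.comp_apply, hz0, hr0] at hlim
    refine hlim.congr' ?_
    have n1 : ∀ᶠ t : ℝ in 𝓝 0, 1 + t * exp (θ * I) ≠ 0 :=
      ContinuousAt.eventually_ne (by fun_prop) (by simp)
    have n2 : ∀ᶠ t : ℝ in 𝓝 0, t * exp (θ * I) - σ * exp (φ * I) ≠ 0 :=
      ContinuousAt.eventually_ne (by fun_prop) (by simp [hσ.ne'])
    filter_upwards [self_mem_nhdsWithin, nhdsWithin_le_nhds n1, nhdsWithin_le_nhds n2]
      with t ht h1 h2
    have e1 : c + t * (d * exp (θ * I)) - (c - d) = t * (d * exp (θ * I)) + d := by ring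
    have e2 : c + t * (d * exp (θ * I)) - c = t * (d * exp (θ * I)) := by ring
    have e3 : c + t * (d * exp (θ * I)) - s =
        t * (d * exp (θ * I)) - σ * (d * exp (φ * I)) := by rw [hs]; ring
    simp only [Function.comp_apply, Pi.sub_apply, hH]
    rw [← log_add_log_eq_radialLog hd ht h1 h2, e1, e2, e3]
  have l₁ := radial θ₁ Real.pi exp_pi_mul_I (by linarith) (by linarith) hθ₁ (by linarith)
  have l₂ := radial θ₂ (-Real.pi) (by
    rw [ofReal_neg, neg_mul, exp_neg, exp_pi_mul_I]; norm_num)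
    (by linarith) (by linarith) (by linarith) hθ₂
  have heq := tendsto_nhds_unique (l₁.congr' ?_) l₂
  · simp only [sub_im, add_im, neg_im, ofReal_im, im_ofReal_mul, I_im] at heq
    linarith [Real.pi_pos]
  · filter_upwards [hW₁, hW₂] with t ht₁ ht₂
    exact hW.im_eq_of_exp_eq_one hHc hH1 ht₁ ht₂

/-! ### The boundary of a square in angular coordinates -/

/-- The vector `d` rotated by the angle `θ`. -/
noncomputable def rotateVec (d : ℝ × ℝ) (θ : ℝ) : ℝ × ℝ :=
  (d.1 * Real.cos θ - d.2 * Real.sin θ, d.1 * Real.sin θ + d.2 * Real.cos θ)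

/-- The vector in the direction of `d` rotated by the angle `θ`, of length one for the sup norm.
As `θ` runs over `[-π, π]` it goes once around the boundary of a square. -/
noncomputable def squareDir (d : ℝ × ℝ) (θ : ℝ) : ℝ × ℝ := ‖rotateVec d θ‖⁻¹ • rotateVec d θ

theorem equivRealProdCLM_symm_rotateVec (d : ℝ × ℝ) (θ : ℝ) :
    equivRealProdCLM.symm (rotateVec d θ) = equivRealProdCLM.symm d * exp (θ * I) := by
  apply Complex.ext <;>
    simp [rotateVec, equivRealProdCLM_symm_apply, exp_re, exp_im, cos_ofReal_re, sin_ofReal_re]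

theorem rotateVec_ne_zero {d : ℝ × ℝ} (hd : d ≠ 0) (θ : ℝ) : rotateVec d θ ≠ 0 := by
  intro h
  have := equivRealProdCLM_symm_rotateVec d θ
  rw [h, map_zero, eq_comm, mul_eq_zero, or_iff_left (exp_ne_zero _)] at this
  exact hd (by simpa using this)

theorem continuous_squareDir {d : ℝ × ℝ} (hd : d ≠ 0) : Continuous (squareDir d) := by
  have h : Continuous (rotateVec d) := by unfold rotateVec; fun_prop
  exact (h.norm.inv₀ fun θ ↦ norm_ne_zero_iff.2 (rotateVec_ne_zero hd θ)).smul h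

theorem norm_squareDir {d : ℝ × ℝ} (hd : d ≠ 0) (θ : ℝ) : ‖squareDir d θ‖ = 1 :=
  norm_smul_inv_norm (𝕜 := ℝ) (rotateVec_ne_zero hd θ)

theorem norm_smul_squareDir {d : ℝ × ℝ} (hd : d ≠ 0) (θ : ℝ) {ρ : ℝ} (hρ : 0 ≤ ρ) :
    ‖ρ • squareDir d θ‖ = ρ := by
  rw [norm_smul, norm_squareDir hd, mul_one, Real.norm_of_nonneg hρ]

theorem norm_smul_squareDir_pi (d : ℝ × ℝ) : ‖d‖ • squareDir d Real.pi = -d := by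
  have h : rotateVec d Real.pi = -d := by simp [rotateVec, Prod.ext_iff]
  rw [squareDir, h, norm_neg, smul_neg, smul_neg]
  rcases eq_or_ne d 0 with rfl | hd
  · simp
  · rw [smul_inv_smul₀ (norm_ne_zero_iff.2 hd)]

theorem squareDir_neg_pi (d : ℝ × ℝ) : squareDir d (-Real.pi) = squareDir d Real.pi := by
  simp [squareDir, rotateVec]

theorem exists_eq_norm_smul_squareDir {d : ℝ × ℝ} (hd : d ≠ 0) (w : ℝ × ℝ) :
    ∃ θ ∈ Ioc (-Real.pi) Real.pi, w = ‖w‖ • squareDir d θ := by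
  set e := equivRealProdCLM.symm
  have hed : e d ≠ 0 := by simpa using hd
  set q := e w / e d with hq
  have hw : w = ‖q‖ • rotateVec d q.arg := by
    apply e.injective
    rw [map_smul, equivRealProdCLM_symm_rotateVec, real_smul]
    calc e w = e d * q := by rw [hq]; field_simp
      _ = e d * (‖q‖ * exp (q.arg * I)) := by rw [norm_mul_exp_arg_mul_I]
      _ = _ := by ring
  refine ⟨q.arg, arg_mem_Ioc q, ?_⟩
  have hn : ‖w‖ = ‖q‖ * ‖rotateVec d q.arg‖ := by
    conv_lhs => rw [hw]
    rw [norm_smul, norm_norm]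
  rw [hn, mul_smul, squareDir, smul_inv_smul₀ (norm_ne_zero_iff.2 (rotateVec_ne_zero hd _))]
  exact hw

theorem squareDir_injOn {d : ℝ × ℝ} (hd : d ≠ 0) :
    InjOn (squareDir d) (Ioc (-Real.pi) Real.pi) := by
  set e := equivRealProdCLM.symm
  have hed : e d ≠ 0 := by simpa using hd
  have key : ∀ θ ∈ Ioc (-Real.pi) Real.pi, (e (squareDir d θ) / e d).arg = θ := by
    intro θ hθ
    have : e (squareDir d θ) / e d =
        ((‖rotateVec d θ‖⁻¹ : ℝ) : ℂ) * (Complex.cos θ + Complex.sin θ * I) := by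
      have h : e (rotateVec d θ) = e d * exp (θ * I) := equivRealProdCLM_symm_rotateVec d θ
      rw [squareDir, map_smul, h, real_smul, exp_mul_I]
      field_simp
    rw [this, arg_mul_cos_add_sin_mul_I
      (inv_pos.2 (norm_pos_iff.2 (rotateVec_ne_zero hd θ))) hθ]
  intro θ hθ φ hφ h
  rw [← key θ hθ, ← key φ hφ, h]

theorem smul_squareDir_ne {d : ℝ × ℝ} (hd : d ≠ 0) {θ φ ρ ρ' : ℝ}
    (hθ : θ ∈ Ioc (-Real.pi) Real.pi) (hφ : φ ∈ Ioc (-Real.pi) Real.pi) (h : θ ≠ φ)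
    (hρ : 0 < ρ) (hρ' : 0 ≤ ρ') : ρ • squareDir d θ ≠ ρ' • squareDir d φ := by
  intro he
  have : ρ = ρ' := by
    rw [← norm_smul_squareDir hd θ hρ.le, he, norm_smul_squareDir hd φ hρ']
  subst this
  exact h (squareDir_injOn hd hθ hφ (smul_right_injective _ hρ.ne' he))

/-- Between two angles less than `π` apart, a direction is a nonnegative combination of the two extreme
directions. The coefficients add up to at least one because all directions have norm one. -/
theorem exists_squareDir_eq_add {d : ℝ × ℝ} (hd : d ≠ 0) {α θ φ : ℝ}
    (hαθ : |θ - α| < Real.pi) (hφ : φ ∈ uIcc α θ) :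
    ∃ x y : ℝ, 0 ≤ x ∧ 0 ≤ y ∧ 1 ≤ x + y ∧
      squareDir d φ = x • squareDir d α + y • squareDir d θ := by
  have norm_le {x y : ℝ} (hx : 0 ≤ x) (hy : 0 ≤ y)
      (h : squareDir d φ = x • squareDir d α + y • squareDir d θ) : 1 ≤ x + y := by
    rw [← norm_squareDir hd φ, h]
    refine (norm_add_le _ _).trans ?_
    rw [norm_smul_squareDir hd _ hx, norm_smul_squareDir hd _ hy]
  suffices ∃ x y : ℝ, 0 ≤ x ∧ 0 ≤ y ∧
      squareDir d φ = x • squareDir d α + y • squareDir d θ by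
    obtain ⟨x, y, hx, hy, h⟩ := this
    exact ⟨x, y, hx, hy, norm_le hx hy h, h⟩
  suffices ∃ x y : ℝ, 0 ≤ x ∧ 0 ≤ y ∧
      rotateVec d φ = x • rotateVec d α + y • rotateVec d θ by
    obtain ⟨x, y, hx, hy, h⟩ := this
    refine ⟨‖rotateVec d φ‖⁻¹ * x * ‖rotateVec d α‖, ‖rotateVec d φ‖⁻¹ * y * ‖rotateVec d θ‖,
      by positivity, by positivity, ?_⟩
    rw [squareDir, squareDir, squareDir, mul_smul, mul_smul,
      smul_inv_smul₀ (norm_ne_zero_iff.2 (rotateVec_ne_zero hd _)),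
      mul_smul, mul_smul, smul_inv_smul₀ (norm_ne_zero_iff.2 (rotateVec_ne_zero hd _)), ← smul_add]
    nth_rewrite 2 [h]
    rfl
  have id : Real.sin (θ - α) • rotateVec d φ =
      Real.sin (θ - φ) • rotateVec d α + Real.sin (φ - α) • rotateVec d θ := by
    ext <;>
    simp only [rotateVec, Prod.smul_fst, Prod.smul_snd, Prod.fst_add, Prod.snd_add, smul_eq_mul,
      Real.sin_sub]
    · ring
    · ring
  obtain ⟨h1, h2⟩ := abs_lt.1 hαθ
  rcases lt_trichotomy α θ with h | h | h
  · rw [uIcc_of_le h.le] at hφ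
    obtain ⟨h3, h4⟩ := hφ
    have hs : 0 < Real.sin (θ - α) := Real.sin_pos_of_pos_of_lt_pi (by linarith) (by linarith)
    refine ⟨Real.sin (θ - φ) / Real.sin (θ - α), Real.sin (φ - α) / Real.sin (θ - α),
      div_nonneg (Real.sin_nonneg_of_nonneg_of_le_pi (by linarith) (by linarith)) hs.le,
      div_nonneg (Real.sin_nonneg_of_nonneg_of_le_pi (by linarith) (by linarith)) hs.le, ?_⟩
    rw [div_eq_inv_mul, div_eq_inv_mul, mul_smul, mul_smul, ← smul_add, ← id,
      inv_smul_smul₀ hs.ne']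
  · subst h
    rw [uIcc_self, mem_singleton_iff] at hφ
    exact ⟨1, 0, by norm_num, le_rfl, by simp [hφ]⟩
  · rw [uIcc_of_ge h.le] at hφ
    obtain ⟨h3, h4⟩ := hφ
    have hs : Real.sin (θ - α) < 0 := Real.sin_neg_of_neg_of_neg_pi_lt (by linarith) (by linarith)
    refine ⟨Real.sin (θ - φ) / Real.sin (θ - α), Real.sin (φ - α) / Real.sin (θ - α),
      div_nonneg_of_nonpos
        (Real.sin_nonpos_of_nonpos_of_neg_pi_le (by linarith) (by linarith)) hs.le,
      div_nonneg_of_nonpos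
        (Real.sin_nonpos_of_nonpos_of_neg_pi_le (by linarith) (by linarith)) hs.le, ?_⟩
    rw [div_eq_inv_mul, div_eq_inv_mul, mul_smul, mul_smul, ← smul_add, ← id,
      inv_smul_smul₀ hs.ne]

/-- One coordinate of `eventually_norm_smul_squareDir_sub_le`. At an interior point of a side there is
room to spare; where the coordinate `g` is extremal, so in particular at a corner, the convexity
hypothesis makes `g φ` at least as close to the extremal value as `g θ`. -/
theorem eventually_abs_mul_sub_le {g : ℝ → ℝ} {α R δ : ℝ} (hg : ContinuousAt g α)
    (hg1 : ∀ θ, |g θ| ≤ 1) (hR : 0 < R) (hδ : 0 < δ)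
    (hconv : ∀ᶠ θ in 𝓝 α, ∀ φ ∈ uIcc α θ,
      ∃ x y : ℝ, 0 ≤ x ∧ 0 ≤ y ∧ 1 ≤ x + y ∧ g φ = x * g α + y * g θ) :
    ∀ᶠ θ in 𝓝 α, ∀ φ ∈ uIcc α θ, ∀ r, δ ≤ r → |R * g φ - (R + r) * g θ| ≤ r := by
  -- A property that holds near `α` holds on the whole interval between `α` and `θ`.
  have spread {p : ℝ → Prop} (h : ∀ᶠ θ in 𝓝 α, p θ) :
      ∀ᶠ θ in 𝓝 α, ∀ φ ∈ uIcc α θ, p φ := by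
    obtain ⟨ε, hε, h⟩ := Metric.eventually_nhds_iff.1 h
    refine Metric.eventually_nhds_iff.2 ⟨ε, hε, fun θ hθ φ hφ ↦ h (lt_of_le_of_lt ?_ hθ)⟩
    rw [Real.dist_eq, Real.dist_eq]
    exact abs_sub_left_of_mem_uIcc hφ
  have near (κ : ℝ) (hκ : 0 < κ) : ∀ᶠ θ in 𝓝 α, ∀ φ ∈ uIcc α θ, |g φ - g α| < κ := by
    refine spread ?_
    have := Metric.continuousAt_iff'.1 hg κ hκ
    simpa only [Real.dist_eq] using this
  -- The case of a maximum; the case of a minimum follows by a change of sign.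
  have atmax {f : ℝ → ℝ} (hf : ∀ κ > 0, ∀ᶠ θ in 𝓝 α, ∀ φ ∈ uIcc α θ, |f φ - f α| < κ)
      (hf1 : ∀ θ, f θ ≤ 1) (hα : f α = 1)
      (hconv : ∀ᶠ θ in 𝓝 α, ∀ φ ∈ uIcc α θ,
        ∃ x y : ℝ, 0 ≤ x ∧ 0 ≤ y ∧ 1 ≤ x + y ∧ f φ = x * f α + y * f θ) :
      ∀ᶠ θ in 𝓝 α, ∀ φ ∈ uIcc α θ, ∀ r, δ ≤ r → |R * f φ - (R + r) * f θ| ≤ r := by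
    filter_upwards [hf (min (1 / 2) (δ / R)) (by positivity), hconv] with θ h1 h2 φ hφ r hr
    obtain ⟨x, y, hx, hy, hxy, he⟩ := h2 φ hφ
    have hθ := h1 θ right_mem_uIcc
    rw [hα] at hθ he
    obtain ⟨ha, hb⟩ := abs_lt.1 hθ
    have m1 := min_le_left (1 / 2) (δ / R)
    have m2 := min_le_right (1 / 2) (δ / R)
    have hθ1 := hf1 θ
    have hφ1 := hf1 φ
    have hge : f θ ≤ f φ := by nlinarith
    have hlt : R * (f φ - f θ) ≤ δ := by
      rw [← le_div_iff₀' hR]; linarith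
    rw [abs_le]
    constructor <;> nlinarith
  rcases lt_or_eq_of_le (hg1 α) with h | h
  · set κ := (1 - |g α|) / 2 with hκ
    have hκ0 : 0 < κ := by rw [hκ]; linarith
    filter_upwards [near (min κ (δ * κ / (2 * R))) (by positivity)] with θ h1 φ hφ r hr
    have hθ := h1 θ right_mem_uIcc
    have hφ := h1 φ hφ
    have m1 := min_le_left κ (δ * κ / (2 * R))
    have m2 := min_le_right κ (δ * κ / (2 * R))
    have hθκ : |g θ| ≤ 1 - κ := by
      have := abs_sub_abs_le_abs_sub (g θ) (g α)
      rw [hκ] at *; linarith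
    have hd : |g φ - g θ| ≤ δ * κ / R := by
      have := abs_sub_le (g φ) (g α) (g θ)
      rw [abs_sub_comm (g α)] at this
      have e : δ * κ / R = δ * κ / (2 * R) + δ * κ / (2 * R) := by field_simp; ring
      rw [e]; linarith
    rw [le_div_iff₀' hR] at hd
    calc |R * g φ - (R + r) * g θ| = |R * (g φ - g θ) - r * g θ| := by ring_nf
      _ ≤ |R * (g φ - g θ)| + |r * g θ| := abs_sub _ _
      _ = R * |g φ - g θ| + r * |g θ| := by
        rw [abs_mul, abs_mul, abs_of_pos hR, abs_of_pos (hδ.trans_le hr)]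
      _ ≤ δ * κ + r * (1 - κ) := by gcongr; exact (hδ.trans_le hr).le
      _ ≤ r := by nlinarith
  · rcases eq_or_eq_neg_of_abs_eq h with h | h
    · exact atmax (fun κ hκ ↦ near κ hκ) (fun θ ↦ (abs_le.1 (hg1 θ)).2) h hconv
    · have := atmax (f := fun θ ↦ -g θ) (fun κ hκ ↦ ?_)
        (fun θ ↦ by linarith [(abs_le.1 (hg1 θ)).1]) (by rw [h, neg_neg]) ?_
      · filter_upwards [this] with θ h1 φ hφ r hr
        have := h1 φ hφ r hr
        rwa [← abs_neg, show -(R * g φ - (R + r) * g θ) = R * -g φ - (R + r) * -g θ by ring]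
      · filter_upwards [near κ hκ] with θ h1 φ hφ
        rw [← abs_neg, show -(-g φ - -g α) = g φ - g α by ring]
        exact h1 φ hφ
      · filter_upwards [hconv] with θ h1 φ hφ
        obtain ⟨x, y, hx, hy, hxy, he⟩ := h1 φ hφ
        exact ⟨x, y, hx, hy, hxy, by rw [he]; ring⟩

/-- A square of radius at least `δ` that touches the square of radius `R` at an angle `θ` close to `α`
contains in its closure the boundary points of all angles between `α` and `θ`. -/
theorem eventually_norm_smul_squareDir_sub_le {d : ℝ × ℝ} (hd : d ≠ 0) (α : ℝ) {R δ : ℝ}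
    (hR : 0 < R) (hδ : 0 < δ) :
    ∀ᶠ θ in 𝓝 α, ∀ φ ∈ uIcc α θ, ∀ r, δ ≤ r →
      ‖R • squareDir d φ - (R + r) • squareDir d θ‖ ≤ r := by
  have hπ : ∀ᶠ θ in 𝓝 α, |θ - α| < Real.pi :=
    (show ContinuousAt (fun θ : ℝ ↦ |θ - α|) α by fun_prop).eventually_lt_const
      (by simpa using Real.pi_pos)
  have hc := continuous_squareDir hd
  have b (θ : ℝ) := (norm_squareDir hd θ).le
  have h1 := eventually_abs_mul_sub_le (g := fun θ ↦ (squareDir d θ).1) (α := α)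
    hc.fst.continuousAt (fun θ ↦ (norm_fst_le _).trans (b θ)) hR hδ (by
      filter_upwards [hπ] with θ h φ hφ
      obtain ⟨x, y, hx, hy, hxy, he⟩ := exists_squareDir_eq_add hd h hφ
      exact ⟨x, y, hx, hy, hxy, by rw [he]; simp⟩)
  have h2 := eventually_abs_mul_sub_le (g := fun θ ↦ (squareDir d θ).2) (α := α)
    hc.snd.continuousAt (fun θ ↦ (norm_snd_le _).trans (b θ)) hR hδ (by
      filter_upwards [hπ] with θ h φ hφ
      obtain ⟨x, y, hx, hy, hxy, he⟩ := exists_squareDir_eq_add hd h hφ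
      exact ⟨x, y, hx, hy, hxy, by rw [he]; simp⟩)
  filter_upwards [h1, h2] with θ h1 h2 φ hφ r hr
  rw [norm_prod_le_iff]
  exact ⟨by simpa using h1 φ hφ r hr, by simpa using h2 φ hφ r hr⟩

/-! ### Crosscuts through the centre of a square -/

theorem not_mem_radius_of_mem_radius {d : ℝ × ℝ} (hd : d ≠ 0) (c : ℝ × ℝ) {θ ψ ρ : ℝ}
    (hθ : θ ∈ Ioc (-Real.pi) Real.pi) (hψ : ψ ∈ Ioc (-Real.pi) Real.pi) (h : θ ≠ ψ) (hρ : 0 < ρ) :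
    c + ρ • squareDir d θ ∉ segment ℝ c (c + ‖d‖ • squareDir d ψ) := by
  rw [segment_eq_image']
  rintro ⟨t, ht, he⟩
  simp only [add_sub_cancel_left, smul_smul] at he
  exact smul_squareDir_ne hd hθ hψ h hρ (by have := ht.1; positivity) (add_left_cancel he).symm

theorem mem_ball_or_eq_of_mem_radius {d : ℝ × ℝ} (hd : d ≠ 0) {c w : ℝ × ℝ} {ψ : ℝ}
    (h : w ∈ segment ℝ c (c + ‖d‖ • squareDir d ψ)) :
    w ∈ ball c ‖d‖ ∨ w = c + ‖d‖ • squareDir d ψ := by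
  rw [segment_eq_image'] at h
  obtain ⟨t, ht, rfl⟩ := h
  have hd' := norm_pos_iff.2 hd
  rcases ht.2.lt_or_eq with h1 | h1
  · left
    simp only [add_sub_cancel_left, smul_smul, mem_ball, dist_self_add_left]
    rw [norm_smul_squareDir hd _ (by have := ht.1; positivity)]
    nlinarith
  · right
    simp [h1]

/-- The crosscut made of the radii of the square `ball c ‖d‖` to `c - d` and to the boundary point of
angle `φ`, and of a segment from there to a point `a` outside `Ω`, separates the boundary points
of angles less than `φ` from those of angles greater than `φ`. -/
theorem not_isPreconnected_across_square {Ω : Set (ℝ × ℝ)} (hsc : IsSimplyConnected Ω)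
    (ho : IsOpen Ω) {c d a : ℝ × ℝ} {φ θ₁ θ₂ : ℝ} (hd : d ≠ 0) (hball : ball c ‖d‖ ⊆ Ω)
    (hb : c - d ∉ Ω) (ha : a ∉ Ω)
    (hθ₁ : -Real.pi < θ₁) (h₁ : θ₁ < φ) (h₂ : φ < θ₂) (hθ₂ : θ₂ < Real.pi)
    (hca : Disjoint (segment ℝ (c + ‖d‖ • squareDir d φ) a) (ball c ‖d‖))
    {V : Set (ℝ × ℝ)} (hVΩ : V ⊆ Ω) (hVS : Disjoint V (ball c ‖d‖))
    (hVa : Disjoint V (segment ℝ (c + ‖d‖ • squareDir d φ) a))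
    (m₁ : c + ‖d‖ • squareDir d θ₁ ∈ V) (m₂ : c + ‖d‖ • squareDir d θ₂ ∈ V) :
    ¬ IsPreconnected V := by
  intro hV
  set e := equivRealProdCLM.symm with he
  have hd' : 0 < ‖d‖ := norm_pos_iff.2 hd
  have hrot (θ : ℝ) : 0 < ‖rotateVec d θ‖ := norm_pos_iff.2 (rotateVec_ne_zero hd θ)
  have hexp (t θ : ℝ) :
      e (c + (t * ‖rotateVec d θ‖) • squareDir d θ) = e c + t * (e d * exp (θ * I)) := by
    have h : e (rotateVec d θ) = e d * exp (θ * I) := equivRealProdCLM_symm_rotateVec d θ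
    rw [squareDir, mul_smul, smul_inv_smul₀ (hrot θ).ne', map_add, map_smul, h, real_smul]
  have hs : e c + ((‖d‖ / ‖rotateVec d φ‖ : ℝ) : ℂ) * (e d * exp (φ * I)) =
      e (c + ‖d‖ • squareDir d φ) := by
    rw [← hexp, div_mul_cancel₀ _ (hrot φ).ne']
  have hbπ : c - d = c + ‖d‖ • squareDir d Real.pi := by
    rw [norm_smul_squareDir_pi, sub_eq_add_neg]
  have mem_seg {w p q : ℝ × ℝ} : e w ∈ segment ℝ (e p) (e q) ↔ w ∈ segment ℝ p q := by
    rw [← e.injective.mem_set_image (s := segment ℝ p q)]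
    have := image_segment ℝ e.toLinearMap.toAffineMap p q
    simp only [LinearMap.coe_toAffineMap] at this
    exact iff_of_eq (congrArg (e w ∈ ·) this.symm)
  let ray (θ : ℝ) : Set (ℝ × ℝ) := (fun t : ℝ ↦ c + t • squareDir d θ) '' Ioc 0 ‖d‖
  have hray (θ : ℝ) : IsPreconnected (ray θ) :=
    isPreconnected_Ioc.image _ (by fun_prop)
  have hend (θ : ℝ) : c + ‖d‖ • squareDir d θ ∈ ray θ := ⟨‖d‖, ⟨hd', le_rfl⟩, rfl⟩
  set W := V ∪ ray θ₁ ∪ ray θ₂ with hW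
  have hWpre : IsPreconnected W :=
    (hV.union _ m₁ (hend θ₁) (hray θ₁)).union _ (Or.inl m₂) (hend θ₂) (hray θ₂)
  have hray_cases {θ : ℝ} (hm : c + ‖d‖ • squareDir d θ ∈ V) {w : ℝ × ℝ} (hw : w ∈ ray θ) :
      w ∈ V ∨ w ∈ ball c ‖d‖ := by
    obtain ⟨t, ht, rfl⟩ := hw
    rcases ht.2.lt_or_eq with h | h
    · right
      simp only [mem_ball, dist_self_add_left]
      rwa [norm_smul_squareDir hd _ ht.1.le]
    · left; simpa only [h] using hm
  have hW_cases {w : ℝ × ℝ} (hw : w ∈ W) : w ∈ V ∨ w ∈ ball c ‖d‖ := by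
    rcases hw with (hw | hw) | hw
    exacts [Or.inl hw, hray_cases m₁ hw, hray_cases m₂ hw]
  have hpi := Real.pi_pos
  have avoid {ψ : ℝ} (hψ : ψ ∈ Ioc (-Real.pi) Real.pi) (h1 : θ₁ ≠ ψ) (h2 : θ₂ ≠ ψ)
      (hn : c + ‖d‖ • squareDir d ψ ∉ V) : ∀ w ∈ W, w ∉ segment ℝ c (c + ‖d‖ • squareDir d ψ) := by
    rintro w ((hw | ⟨t, ht, rfl⟩) | ⟨t, ht, rfl⟩)
    · intro hseg
      rcases mem_ball_or_eq_of_mem_radius hd hseg with h | h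
      · exact hVS.notMem_of_mem_left hw h
      · exact hn (h ▸ hw)
    · exact not_mem_radius_of_mem_radius hd c ⟨by linarith, by linarith⟩ hψ h1 ht.1
    · exact not_mem_radius_of_mem_radius hd c ⟨by linarith, by linarith⟩ hψ h2 ht.1
  have htend (θ : ℝ) (hr : ray θ ⊆ W) :
      ∀ᶠ t : ℝ in 𝓝[>] 0, e c + t * (e d * exp (θ * I)) ∈ e '' W := by
    have h0 : ∀ᶠ t : ℝ in 𝓝 0, t * ‖rotateVec d θ‖ < ‖d‖ :=
      (show ContinuousAt (fun t : ℝ ↦ t * ‖rotateVec d θ‖) 0 by fun_prop).eventually_lt_const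
        (by simpa using hd')
    filter_upwards [self_mem_nhdsWithin, nhdsWithin_le_nhds h0] with t ht h
    rw [← hexp]
    exact mem_image_of_mem _ (hr ⟨_, ⟨mul_pos ht (hrot θ), h.le⟩, rfl⟩)
  refine not_isPreconnected_across_crosscut (U := e '' Ω) (a := e a) (c := e c) (d := e d)
    (σ := ‖d‖ / ‖rotateVec d φ‖) (φ := φ) (W := e '' W)
    (e.toHomeomorph.isSimplyConnected_image.2 hsc) (e.toHomeomorph.isOpenMap _ ho) (by simpa using hd)
    (div_pos hd' (hrot φ)) hθ₁ h₁ h₂ hθ₂ (mem_image_of_mem _ (hball (mem_ball_self hd')))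
    ?_ ?_ ?_ ?_ ?_ ?_ ?_ (htend θ₁ fun w hw ↦ Or.inl (Or.inr hw)) (htend θ₂ fun w hw ↦ Or.inr hw)
    (hWpre.image _ e.continuous.continuousOn)
  · rwa [← map_sub, e.injective.mem_set_image]
  · rwa [e.injective.mem_set_image]
  · rw [hs, mem_seg]
    exact fun h ↦ hca.notMem_of_mem_left h (mem_ball_self hd')
  · refine image_mono fun w hw ↦ ?_
    rcases hW_cases hw with h | h
    exacts [hVΩ h, hball h]
  · rintro _ ⟨w, hw, rfl⟩
    rw [← map_sub, mem_seg, segment_symm, hbπ]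
    exact avoid ⟨by linarith, le_rfl⟩ (by linarith) (by linarith)
      (fun h ↦ hb (hbπ ▸ hVΩ h)) w hw
  · rintro _ ⟨w, hw, rfl⟩
    rw [hs, mem_seg]
    exact avoid ⟨by linarith, by linarith⟩ h₁.ne h₂.ne'
      (fun h ↦ hVa.notMem_of_mem_left h (left_mem_segment ℝ _ _)) w hw
  · rintro _ ⟨w, hw, rfl⟩
    rw [hs, mem_seg]
    intro hseg
    rcases hW_cases hw with h | h
    · exact hVa.notMem_of_mem_left h hseg
    · exact hca.notMem_of_mem_left hseg h

/-! ### Touching squares -/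

/-- The centre of the square of radius `r` that touches `ball c ‖d‖` from outside at the boundary
point `c + ‖d‖ • squareDir d θ` and lies on the radius through that point. -/
noncomputable def touchCenter (c d : ℝ × ℝ) (θ r : ℝ) : ℝ × ℝ := c + (‖d‖ + r) • squareDir d θ

/-- The touching square of radius `r` at the angle `θ` does not meet the complement of `Ω`.
The value `r = 0`, a degenerate square, is allowed, and so the condition is closed in `(θ, r)`. -/
def TouchAdmissible (Ω : Set (ℝ × ℝ)) (c d : ℝ × ℝ) (θ r : ℝ) : Prop :=
  0 ≤ r ∧ r ≤ infDist (touchCenter c d θ r) Ωᶜ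

/-- The angles at which some admissible touching square has a closure that meets `V`. -/
def hitAngles (Ω : Set (ℝ × ℝ)) (c d : ℝ × ℝ) (V : Set (ℝ × ℝ)) : Set ℝ :=
  {θ | ∃ r, TouchAdmissible Ω c d θ r ∧ (closedBall (touchCenter c d θ r) r ∩ V).Nonempty}

/-- Outside the square `ball c ‖d‖`, the point `B` is joined within `Ω` to the boundary point of
that square at angle `θ'` by a continuum that avoids the touching squares at angle `θ`. -/
def LinkedAvoiding (Ω : Set (ℝ × ℝ)) (c d B : ℝ × ℝ) (θ θ' : ℝ) : Prop :=
  ∃ V, IsCompact V ∧ IsPreconnected V ∧ V ⊆ Ω ∧ Disjoint V (ball c ‖d‖) ∧ B ∈ V ∧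
    c + ‖d‖ • squareDir d θ' ∈ V ∧ θ ∉ hitAngles Ω c d V

section Touching

variable {Ω : Set (ℝ × ℝ)} {c d : ℝ × ℝ}

theorem dist_touchCenter (hd : d ≠ 0) (θ : ℝ) {r : ℝ} (hr : 0 ≤ r) :
    dist (touchCenter c d θ r) c = ‖d‖ + r := by
  rw [touchCenter, dist_self_add_left, norm_smul_squareDir hd _ (by positivity)]

theorem dist_touchCenter_touchCenter (hd : d ≠ 0) (θ r r' : ℝ) :
    dist (touchCenter c d θ r) (touchCenter c d θ r') = |r - r'| := by
  rw [touchCenter, touchCenter, dist_add_left, dist_eq_norm, ← sub_smul, norm_smul,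
    norm_squareDir hd, mul_one, add_sub_add_left_eq_sub, Real.norm_eq_abs]

theorem touchCenter_zero (c d : ℝ × ℝ) (θ : ℝ) :
    touchCenter c d θ 0 = c + ‖d‖ • squareDir d θ := by rw [touchCenter, add_zero]

theorem closedBall_touchCenter_subset (hd : d ≠ 0) (θ : ℝ) {r r' : ℝ} (h : r ≤ r') :
    closedBall (touchCenter c d θ r) r ⊆ closedBall (touchCenter c d θ r') r' := by
  apply closedBall_subset_closedBall'
  rw [dist_touchCenter_touchCenter hd, abs_of_nonpos (by linarith)]
  linarith

theorem touchPoint_mem_closedBall (hd : d ≠ 0) (θ : ℝ) {r : ℝ} (hr : 0 ≤ r) :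
    c + ‖d‖ • squareDir d θ ∈ closedBall (touchCenter c d θ r) r := by
  rw [← touchCenter_zero, mem_closedBall, dist_touchCenter_touchCenter hd, zero_sub, abs_neg,
    abs_of_nonneg hr]

theorem disjoint_closedBall_touchCenter (hd : d ≠ 0) (θ : ℝ) {r : ℝ} (hr : 0 ≤ r) :
    Disjoint (closedBall (touchCenter c d θ r) r) (ball c ‖d‖) :=
  closedBall_disjoint_ball (by rw [dist_touchCenter hd θ hr]; linarith)

theorem continuous_touchCenter (hd : d ≠ 0) :
    Continuous fun p : ℝ × ℝ ↦ touchCenter c d p.1 p.2 := by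
  have := continuous_squareDir hd
  unfold touchCenter
  fun_prop

theorem TouchAdmissible.ball_subset {θ r : ℝ} (h : TouchAdmissible Ω c d θ r) :
    ball (touchCenter c d θ r) r ⊆ Ω :=
  (ball_subset_ball h.2).trans ball_infDist_compl_subset

theorem TouchAdmissible.le_of_subset {θ r M : ℝ} (h : TouchAdmissible Ω c d θ r) (hd : d ≠ 0)
    (hM : 0 ≤ M) (hΩ : Ω ⊆ closedBall c M) : r ≤ M := by
  rcases h.1.eq_or_lt with h0 | h0
  · rwa [← h0]
  · have := mem_closedBall.1 (hΩ (h.ball_subset (mem_ball_self h0)))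
    rw [dist_touchCenter hd θ h.1] at this
    linarith [norm_nonneg d]

theorem isClosed_touchAdmissible (hd : d ≠ 0) :
    IsClosed {p : ℝ × ℝ | TouchAdmissible Ω c d p.1 p.2} :=
  (isClosed_le continuous_const continuous_snd).inter
    (isClosed_le continuous_snd ((continuous_infDist_pt _).comp (continuous_touchCenter hd)))

theorem exists_subset_closedBall (hb : Bornology.IsBounded Ω) (c : ℝ × ℝ) :
    ∃ M, 0 ≤ M ∧ Ω ⊆ closedBall c M := by
  obtain ⟨M, hM⟩ := hb.subset_closedBall c
  exact ⟨max M 0, le_max_right _ _, hM.trans (closedBall_subset_closedBall (le_max_left _ _))⟩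

/-- Avoiding a compact set is an open condition on the angle: the admissible pairs `(θ, r)` form a
closed set with bounded `r`, although the greatest admissible `r` need not depend continuously
on `θ`. -/
theorem isClosed_hitAngles (hd : d ≠ 0) (hb : Bornology.IsBounded Ω) {V : Set (ℝ × ℝ)}
    (hV : IsCompact V) : IsClosed (hitAngles Ω c d V) := by
  obtain ⟨M, hM0, hM⟩ := exists_subset_closedBall hb c
  set T : Set (ℝ × (ℝ × (ℝ × ℝ))) := {p | TouchAdmissible Ω c d p.1 p.2.1 ∧
    dist p.2.2 (touchCenter c d p.1 p.2.1) ≤ p.2.1} ∩ univ ×ˢ (Icc 0 M ×ˢ V) with hT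
  have hTc : IsClosed T := by
    refine IsClosed.inter (IsClosed.inter ?_ ?_)
      (isClosed_univ.prod (isClosed_Icc.prod hV.isClosed))
    · exact (isClosed_touchAdmissible hd).preimage
        (show Continuous fun p : ℝ × (ℝ × (ℝ × ℝ)) ↦ (p.1, p.2.1) by fun_prop)
    · exact isClosed_le (continuous_snd.snd.dist ((continuous_touchCenter hd).comp
        (show Continuous fun p : ℝ × (ℝ × (ℝ × ℝ)) ↦ (p.1, p.2.1) by fun_prop))) (by fun_prop)
  have hK : IsCompact (Icc 0 M ×ˢ V) := isCompact_Icc.prod hV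
  have : hitAngles Ω c d V = Prod.fst '' T := by
    ext θ
    constructor
    · rintro ⟨r, hr, v, hv, hvV⟩
      exact ⟨(θ, r, v), ⟨⟨hr, hv⟩, mem_univ _, ⟨hr.1, hr.le_of_subset hd hM0 hM⟩, hvV⟩, rfl⟩
    · rintro ⟨⟨θ', r, v⟩, ⟨⟨hr, hv⟩, -, -, hvV⟩, rfl⟩
      exact ⟨r, hr, v, hv, hvV⟩
  rw [this]
  have hTK : T ⊆ univ ×ˢ (Icc 0 M ×ˢ V) := inter_subset_right
  refine isSeqClosed_iff_isClosed.1 fun u x hu hx ↦ ?_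
  choose p hp hpu using hu
  obtain ⟨q, hq, ψ, hψ, hlim⟩ := hK.tendsto_subseq (fun n ↦ (hTK (hp n)).2)
  refine ⟨(x, q), ?_, rfl⟩
  refine hTc.mem_of_tendsto ((hx.comp hψ.tendsto_atTop).prodMk_nhds hlim)
    (Eventually.of_forall fun n ↦ ?_)
  have : (u (ψ n), (p (ψ n)).2) = p (ψ n) := by rw [← hpu]
  simp only [Function.comp]
  rw [this]
  exact hp _

theorem exists_isGreatest_touchAdmissible (hd : d ≠ 0) (hb : Bornology.IsBounded Ω) (θ : ℝ) :
    ∃ r, IsGreatest {r | TouchAdmissible Ω c d θ r} r := by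
  obtain ⟨M, hM0, hM⟩ := exists_subset_closedBall hb c
  have hcl : IsClosed {r | TouchAdmissible Ω c d θ r} :=
    (isClosed_touchAdmissible hd).preimage (show Continuous fun r : ℝ ↦ (θ, r) by fun_prop)
  have hcpt : IsCompact {r | TouchAdmissible Ω c d θ r} :=
    isCompact_Icc.of_isClosed_subset hcl fun r hr ↦ ⟨hr.1, hr.le_of_subset hd hM0 hM⟩
  exact hcpt.exists_isGreatest ⟨0, le_rfl, infDist_nonneg⟩

/-- The greatest admissible touching square cannot be enlarged because it reaches the complement of
`Ω`. -/
theorem exists_mem_closedBall_of_isGreatest (hd : d ≠ 0) (ho : IsOpen Ω)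
    (hne : (Ωᶜ).Nonempty) {θ r : ℝ} (hr : IsGreatest {r | TouchAdmissible Ω c d θ r} r) :
    ∃ a ∉ Ω, a ∈ closedBall (touchCenter c d θ r) r := by
  obtain ⟨a, ha, hda⟩ := ho.isClosed_compl.exists_infDist_eq_dist hne (touchCenter c d θ r)
  refine ⟨a, ha, ?_⟩
  rw [mem_closedBall', ← hda]
  by_contra! hlt
  set η := (infDist (touchCenter c d θ r) Ωᶜ - r) / 2 with hη
  have hη0 : 0 < η := by rw [hη]; linarith
  -- The centre moves by `η` while the distance to the complement exceeds `r` by `2 * η`.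
  have : TouchAdmissible Ω c d θ (r + η) := by
    refine ⟨by linarith [hr.1.1], ?_⟩
    have := infDist_le_infDist_add_dist (s := Ωᶜ) (x := touchCenter c d θ r)
      (y := touchCenter c d θ (r + η))
    rw [dist_touchCenter_touchCenter hd, sub_add_cancel_left, abs_neg, abs_of_pos hη0] at this
    linarith
  linarith [hr.2 this]

theorem pos_of_isGreatest (hd : d ≠ 0) (ho : IsOpen Ω)
    (hne : (Ωᶜ).Nonempty) {θ r : ℝ} (hr : IsGreatest {r | TouchAdmissible Ω c d θ r} r)
    (hθ : c + ‖d‖ • squareDir d θ ∈ Ω) : 0 < r := by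
  refine lt_of_le_of_ne hr.1.1 fun h ↦ ?_
  obtain ⟨a, ha, hda⟩ := exists_mem_closedBall_of_isGreatest hd ho hne hr
  rw [← h, closedBall_zero, touchCenter_zero, mem_singleton_iff] at hda
  exact ha (hda ▸ hθ)

theorem not_mem_hitAngles_of_isGreatest (hd : d ≠ 0) {θ r : ℝ} {V : Set (ℝ × ℝ)}
    (hr : IsGreatest {r | TouchAdmissible Ω c d θ r} r)
    (hV : Disjoint V (closedBall (touchCenter c d θ r) r)) : θ ∉ hitAngles Ω c d V := by
  rintro ⟨r', hr', v, hv, hvV⟩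
  exact hV.notMem_of_mem_left hvV (closedBall_touchCenter_subset hd θ (hr.2 hr') hv)

/-- The greatest admissible touching square at `θ`, together with a point of its boundary outside
`Ω`, separates the boundary points of the given square before `θ` from those after `θ`. -/
theorem LinkedAvoiding.false_of_lt_of_lt (hsc : IsSimplyConnected Ω)
    (ho : IsOpen Ω) (hbd : Bornology.IsBounded Ω) (hd : d ≠ 0) (hball : ball c ‖d‖ ⊆ Ω)
    (hb : c - d ∉ Ω) {B : ℝ × ℝ} {θ θ₁ θ₂ : ℝ} (l₁ : LinkedAvoiding Ω c d B θ θ₁)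
    (l₂ : LinkedAvoiding Ω c d B θ θ₂)
    (hθ₁ : -Real.pi < θ₁) (h₁ : θ₁ < θ) (h₂ : θ < θ₂) (hθ₂ : θ₂ < Real.pi) : False := by
  obtain ⟨V₁, -, p₁, s₁, d₁, b₁, m₁, n₁⟩ := l₁
  obtain ⟨V₂, -, p₂, s₂, d₂, b₂, m₂, n₂⟩ := l₂
  obtain ⟨r, hr⟩ := exists_isGreatest_touchAdmissible (c := c) hd hbd θ
  obtain ⟨a, ha, har⟩ := exists_mem_closedBall_of_isGreatest hd ho ⟨_, hb⟩ hr
  have hseg : segment ℝ (c + ‖d‖ • squareDir d θ) a ⊆ closedBall (touchCenter c d θ r) r :=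
    (convex_closedBall _ _).segment_subset (touchPoint_mem_closedBall hd θ hr.1.1) har
  have avoid {V : Set (ℝ × ℝ)} (n : θ ∉ hitAngles Ω c d V) :
      Disjoint V (segment ℝ (c + ‖d‖ • squareDir d θ) a) :=
    disjoint_left.2 fun v hv hvs ↦ n ⟨r, hr.1, v, hseg hvs, hv⟩
  exact not_isPreconnected_across_square hsc ho hd hball hb ha hθ₁ h₁ h₂ hθ₂
    ((disjoint_closedBall_touchCenter hd θ hr.1.1).mono_left hseg)
    (union_subset s₁ s₂) (disjoint_union_left.2 ⟨d₁, d₂⟩)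
    (disjoint_union_left.2 ⟨avoid n₁, avoid n₂⟩) (Or.inl m₁) (Or.inr m₂) (p₁.union B b₁ b₂ p₂)

/-- At angles close to that of a boundary point outside `Ω`, an admissible touching square that
reaches the fixed compact set `V₀` is not small, and hence covers the boundary between. -/
theorem eventually_touchPoint_not_mem (hd : d ≠ 0) {α : ℝ}
    (hα : c + ‖d‖ • squareDir d α ∉ Ω) {V₀ : Set (ℝ × ℝ)} (hV₀ : IsCompact V₀) (hV₀Ω : V₀ ⊆ Ω) :
    ∀ᶠ θ in 𝓝 α, θ ∈ hitAngles Ω c d V₀ → ∀ V : Set (ℝ × ℝ), θ ∉ hitAngles Ω c d V →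
      ∀ φ ∈ uIcc α θ, c + ‖d‖ • squareDir d φ ∉ V := by
  rcases V₀.eq_empty_or_nonempty with rfl | hne
  · refine Eventually.of_forall fun θ h ↦ ?_
    obtain ⟨r, -, v, -, hv⟩ := h
    exact hv.elim
  set η := infDist (c + ‖d‖ • squareDir d α) V₀ with hη
  have hη0 : 0 < η := (hV₀.isClosed.notMem_iff_infDist_pos hne).1 fun h ↦ hα (hV₀Ω h)
  have hcont : Continuous fun θ ↦ c + ‖d‖ • squareDir d θ := by
    have := continuous_squareDir hd
    fun_prop
  filter_upwards [Metric.continuousAt_iff'.1 hcont.continuousAt (η / 2) (by positivity),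
    eventually_norm_smul_squareDir_sub_le hd α (norm_pos_iff.2 hd) (δ := η / 4) (by positivity)]
    with θ h1 h2 ⟨r, hr, v, hv, hvV⟩ V hθV φ hφ hφV
  refine hθV ⟨r, hr, _, ?_, hφV⟩
  rw [mem_closedBall, touchCenter, dist_add_left, dist_eq_norm]
  refine h2 φ hφ r ?_
  have t1 : η ≤ dist (c + ‖d‖ • squareDir d α) v := infDist_le_dist_of_mem hvV
  have t2 := dist_triangle4 (c + ‖d‖ • squareDir d α) (c + ‖d‖ • squareDir d θ)
    (touchCenter c d θ r) v
  have t3 := mem_closedBall.1 (touchPoint_mem_closedBall (c := c) hd θ hr.1)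
  rw [dist_comm] at h1
  have t4 := mem_closedBall'.1 hv
  linarith

end Touching

/-- A path from outside a ball to its interior, stopped when it first reaches the sphere. -/
theorem JoinedIn.exists_continuum_to_sphere {X : Type*} [PseudoMetricSpace X] {U : Set X}
    {B c p : X} {R : ℝ} (h : JoinedIn U B p) (hB : B ∉ closedBall c R) (hp : p ∈ ball c R) :
    ∃ V, IsCompact V ∧ IsPreconnected V ∧ V ⊆ U ∧ Disjoint V (ball c R) ∧ B ∈ V ∧
      ∃ q ∈ V, dist q c = R := by
  obtain ⟨γ, hγ⟩ := h
  rw [mem_closedBall, not_le] at hB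
  have hf : Continuous fun t ↦ dist (γ t) c := γ.continuous.dist continuous_const
  have hT : IsClosed {t | dist (γ t) c ≤ R} := isClosed_le hf continuous_const
  obtain ⟨t₀, ht₀, hmin⟩ := hT.isCompact.exists_isLeast
    ⟨1, by simpa using (mem_ball.1 hp).le⟩
  have heq : dist (γ t₀) c = R := by
    obtain ⟨t, ht, hR⟩ := intermediate_value_Icc' (zero_le (a := t₀)) hf.continuousOn
      (show R ∈ Icc (dist (γ t₀) c) (dist (γ 0) c) from ⟨ht₀, by simpa using hB.le⟩)
    rwa [← le_antisymm ht.2 (hmin (show dist (γ t) c ≤ R from hR.le))]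
  refine ⟨γ '' Icc 0 t₀, isCompact_Icc.image γ.continuous,
    isPreconnected_Icc.image _ γ.continuous.continuousOn, ?_, ?_,
    ⟨0, ⟨le_rfl, zero_le⟩, γ.source⟩, γ t₀, ⟨t₀, ⟨zero_le, le_rfl⟩, rfl⟩, heq⟩
  · rintro _ ⟨t, -, rfl⟩
    exact hγ t
  · rw [disjoint_left]
    rintro _ ⟨t, ht, rfl⟩ hb
    have := le_antisymm ht.2 (hmin (show dist (γ t) c ≤ R from (mem_ball.1 hb).le))
    rw [this, mem_ball, heq] at hb
    exact lt_irrefl _ hb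

/-! ### Existence of a separating square -/

theorem axisSquare_eq_ball (c : ℝ × ℝ) (r : ℝ) : axisSquare c r = ball c r := by
  ext z
  simp [axisSquare, Prod.dist_eq, Real.dist_eq]

theorem exists_touchPoint_eq {Ω : Set (ℝ × ℝ)} {c d q : ℝ × ℝ} (hd : d ≠ 0) (hb : c - d ∉ Ω)
    (hq : q ∈ Ω) (hqd : dist q c = ‖d‖) :
    ∃ θ, -Real.pi < θ ∧ θ < Real.pi ∧ q = c + ‖d‖ • squareDir d θ := by
  obtain ⟨θ, hθ, h⟩ := exists_eq_norm_smul_squareDir hd (q - c)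
  rw [← dist_eq_norm, hqd, sub_eq_iff_eq_add'] at h
  refine ⟨θ, hθ.1, lt_of_le_of_ne hθ.2 ?_, h⟩
  rintro rfl
  rw [norm_smul_squareDir_pi, ← sub_eq_add_neg] at h
  exact hb (h ▸ hq)

/-- If no touching square contains `B` in its closure or separates `B` from the given square, then
`B` is linked to a boundary point of the given square while avoiding the touching squares. -/
theorem exists_linkedAvoiding {Ω : Set (ℝ × ℝ)} (ho : IsOpen Ω) (hbd : Bornology.IsBounded Ω)
    {c d B : ℝ × ℝ} (hd : d ≠ 0) (hball : ball c ‖d‖ ⊆ Ω) (hb : c - d ∉ Ω)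
    (hB : B ∈ Ω) (hBS : B ∉ closedBall c ‖d‖)
    (H : ∀ z r, 0 < r → ball z r ⊆ Ω \ closedBall c ‖d‖ →
      (closedBall z r ∩ closedBall c ‖d‖ ∩ Ω).Nonempty → B ∉ closedBall z r ∧
        ¬ LieInDifferentComponents (Ω \ closedBall z r) (ball c ‖d‖) B)
    {θ : ℝ} (hθ : c + ‖d‖ • squareDir d θ ∈ Ω) :
    ∃ θ', -Real.pi < θ' ∧ θ' < Real.pi ∧ θ' ≠ θ ∧ LinkedAvoiding Ω c d B θ θ' := by
  obtain ⟨r, hr⟩ := exists_isGreatest_touchAdmissible (c := c) hd hbd θ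
  have hr0 : 0 < r := pos_of_isGreatest hd ho ⟨_, hb⟩ hr hθ
  set z := touchCenter c d θ r with hz
  have hd' : 0 < ‖d‖ := norm_pos_iff.2 hd
  have hdisj : Disjoint (closedBall z r) (ball c ‖d‖) := disjoint_closedBall_touchCenter hd θ hr0.le
  have hzmem : c + ‖d‖ • squareDir d θ ∈ closedBall z r := touchPoint_mem_closedBall hd θ hr0.le
  obtain ⟨hBQ, hcomp⟩ := H z r hr0
    (fun w hw ↦ ⟨hr.1.ball_subset hw, fun hwS ↦
      (closedBall_disjoint_ball (x := c) (y := z) (δ := ‖d‖) (ε := r)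
        (by rw [dist_comm, dist_touchCenter hd θ hr0.le])).notMem_of_mem_left hwS hw⟩)
    ⟨_, ⟨hzmem, by
      rw [mem_closedBall, dist_self_add_left, norm_smul_squareDir hd _ hd'.le]⟩, hθ⟩
  set U := Ω \ closedBall z r with hU
  have hUo : IsOpen U := ho.sdiff isClosed_closedBall
  have hSU : ball c ‖d‖ ⊆ U := fun w hw ↦ ⟨hball hw, hdisj.notMem_of_mem_right hw⟩
  have hcU : c ∈ U := hSU (mem_ball_self hd')
  have hBU : B ∈ U := ⟨hB, hBQ⟩
  have hmem : c ∈ connectedComponentIn U B := by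
    by_contra hne
    refine hcomp ⟨c, hcU, B, hBU, (convex_ball c ‖d‖).isPreconnected.subset_connectedComponentIn
      (mem_ball_self hd') hSU, mem_connectedComponentIn hBU, fun he ↦ hne ?_⟩
    exact he ▸ mem_connectedComponentIn hcU
  have hjoin : JoinedIn U B c :=
    ((hUo.connectedComponentIn.isConnected_iff_isPathConnected.1
      (isConnected_connectedComponentIn_iff.2 hBU)).joinedIn B (mem_connectedComponentIn hBU)
      c hmem).mono (connectedComponentIn_subset U B)
  obtain ⟨V, hVc, hVp, hVU, hVS, hBV, q, hqV, hq⟩ :=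
    hjoin.exists_continuum_to_sphere hBS (mem_ball_self hd')
  obtain ⟨θ', h1, h2, rfl⟩ := exists_touchPoint_eq hd hb (hVU hqV).1 hq
  refine ⟨θ', h1, h2, ?_, V, hVc, hVp, fun v hv ↦ (hVU hv).1, hVS, hBV, hqV,
    not_mem_hitAngles_of_isGreatest hd hr (disjoint_left.2 fun v hv ↦ (hVU hv).2)⟩
  rintro rfl
  exact (hVU hqV).2 hzmem

theorem exists_separating_ball {Ω : Set (ℝ × ℝ)} (ho : IsOpen Ω) (hsc : IsSimplyConnected Ω)
    (hbd : Bornology.IsBounded Ω) {c d B : ℝ × ℝ} (hd : d ≠ 0) (hball : ball c ‖d‖ ⊆ Ω)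
    (hb : c - d ∉ Ω) (hB : B ∈ Ω) (hBS : B ∉ closedBall c ‖d‖) :
    ∃ z r, 0 < r ∧ ball z r ⊆ Ω \ closedBall c ‖d‖ ∧
      (closedBall z r ∩ closedBall c ‖d‖ ∩ Ω).Nonempty ∧ (B ∈ closedBall z r ∨
        LieInDifferentComponents (Ω \ closedBall z r) (ball c ‖d‖) B) := by
  by_contra! H
  have hd' : 0 < ‖d‖ := norm_pos_iff.2 hd
  have hpi := Real.pi_pos
  have hcont : Continuous fun θ ↦ c + ‖d‖ • squareDir d θ := by
    have := continuous_squareDir hd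
    fun_prop
  have link {θ : ℝ} (hθ : c + ‖d‖ • squareDir d θ ∈ Ω) :=
    exists_linkedAvoiding ho hbd hd hball hb hB hBS H hθ
  have hπ : c + ‖d‖ • squareDir d Real.pi ∉ Ω := by
    rwa [norm_smul_squareDir_pi, ← sub_eq_add_neg]
  -- A continuum `V₀` joins `B` to the boundary point at some angle `θ₀`, and `(α, β)` is the
  -- largest interval of angles around `θ₀` whose boundary points lie in `Ω`.
  obtain ⟨V₀, hV₀c, hV₀p, hV₀Ω, hV₀S, hBV₀, q, hqV₀, hq⟩ :=
    (hsc.isPathConnected.joinedIn B hB c (hball (mem_ball_self hd'))).exists_continuum_to_sphere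
      hBS (mem_ball_self hd')
  obtain ⟨θ₀, hθ₀l, hθ₀r, rfl⟩ := exists_touchPoint_eq hd hb (hV₀Ω hqV₀) hq
  have hcl : IsClosed {θ | c + ‖d‖ • squareDir d θ ∉ Ω} := ho.isClosed_compl.preimage hcont
  obtain ⟨α, ⟨hαΩ, hαl, hαr⟩, hαmax⟩ :=
    (isCompact_Icc.inter_left hcl : IsCompact (_ ∩ Icc (-Real.pi) θ₀)).exists_isGreatest
      ⟨-Real.pi, by rwa [mem_ofPred_eq, squareDir_neg_pi], le_rfl, hθ₀l.le⟩
  obtain ⟨β, ⟨hβΩ, hβl, hβr⟩, hβmin⟩ :=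
    (isCompact_Icc.inter_left hcl : IsCompact (_ ∩ Icc θ₀ Real.pi)).exists_isLeast
      ⟨Real.pi, hπ, hθ₀r.le, le_rfl⟩
  have hα₀ : α < θ₀ := lt_of_le_of_ne hαr (by rintro rfl; exact hαΩ (hV₀Ω hqV₀))
  have hβ₀ : θ₀ < β := lt_of_le_of_ne hβl (by rintro rfl; exact hβΩ (hV₀Ω hqV₀))
  have hI : ∀ θ ∈ Ioo α β, c + ‖d‖ • squareDir d θ ∈ Ω := by
    intro θ hθ
    by_contra hn
    rcases le_total θ θ₀ with h | h
    · exact absurd (hαmax ⟨hn, by linarith [hθ.1], h⟩) (not_le.2 hθ.1)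
    · exact absurd (hβmin ⟨hn, h, by linarith [hθ.2]⟩) (not_le.2 hθ.2)
  have hopen (θ' : ℝ) : IsOpen {θ | LinkedAvoiding Ω c d B θ θ'} := by
    rw [isOpen_iff_mem_nhds]
    rintro θ ⟨V, hVc, hVp, hVΩ, hVS, hBV, hV, hθ⟩
    filter_upwards [(isClosed_hitAngles hd hbd hVc).isOpen_compl.mem_nhds hθ] with φ hφ
    exact ⟨V, hVc, hVp, hVΩ, hVS, hBV, hV, hφ⟩
  -- `A` and `A'`: the angles before, respectively after, which there is a linked angle.
  set A : Set ℝ := ⋃ θ' > -Real.pi, {θ | LinkedAvoiding Ω c d B θ θ'} ∩ Ioi θ' with hA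
  set A' : Set ℝ := ⋃ θ' < Real.pi, {θ | LinkedAvoiding Ω c d B θ θ'} ∩ Iio θ' with hA'
  have hAo : IsOpen A := isOpen_biUnion fun θ' _ ↦ (hopen θ').inter isOpen_Ioi
  have hAo' : IsOpen A' := isOpen_biUnion fun θ' _ ↦ (hopen θ').inter isOpen_Iio
  have hAA' : Disjoint A A' := by
    rw [disjoint_left]
    intro θ h h'
    simp only [hA, hA', mem_iUnion] at h h'
    obtain ⟨θ₁, hl, l₁, h₁⟩ := h
    obtain ⟨θ₂, hr, l₂, h₂⟩ := h'
    exact l₁.false_of_lt_of_lt hsc ho hbd hd hball hb l₂ hl h₁ h₂ hr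
  have hcover : Ioo α β ⊆ A ∪ A' := by
    intro θ hθ
    obtain ⟨θ', hl, hr, hne, h⟩ := link (hI θ hθ)
    rcases hne.lt_or_gt with h' | h'
    · exact Or.inl (mem_biUnion (x := θ') hl ⟨h, h'⟩)
    · exact Or.inr (mem_biUnion (x := θ') hr ⟨h, h'⟩)
  -- A boundary point outside `Ω` separates the boundary points before it from those after it.
  have across {V : Set (ℝ × ℝ)} (hVp : IsPreconnected V) (hVΩ : V ⊆ Ω)
      (hVS : Disjoint V (ball c ‖d‖)) (hBV : B ∈ V) {θ₁ γ θ₂ : ℝ}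
      (hγ : c + ‖d‖ • squareDir d γ ∉ Ω) (hθ₁ : -Real.pi < θ₁) (h₁ : θ₁ < γ) (h₂ : γ < θ₂)
      (hθ₂ : θ₂ < Real.pi) (m₁ : c + ‖d‖ • squareDir d θ₁ ∈ V ∪ V₀)
      (m₂ : c + ‖d‖ • squareDir d θ₂ ∈ V ∪ V₀) : False := by
    refine not_isPreconnected_across_square hsc ho hd hball hb hγ hθ₁ h₁ h₂ hθ₂ ?_
      (union_subset hVΩ hV₀Ω) (disjoint_union_left.2 ⟨hVS, hV₀S⟩) ?_ m₁ m₂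
      (hVp.union B hBV hBV₀ hV₀p)
    · rw [segment_same, disjoint_singleton_left, mem_ball, dist_self_add_left,
        norm_smul_squareDir hd _ hd'.le]
      exact lt_irrefl _
    · rw [segment_same, disjoint_singleton_right]
      exact fun h ↦ hγ (union_subset hVΩ hV₀Ω h)
  rcases isPreconnected_Ioo.subset_or_subset hAo hAo' hAA' hcover with h | h
  · have hev := (eventually_touchPoint_not_mem hd hαΩ hV₀c hV₀Ω).filter_mono
      (nhdsWithin_le_nhds (s := Ioi α))
    obtain ⟨θ, hθ, hθI⟩ := (hev.and (Ioo_mem_nhdsGT hα₀)).exists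
    have hθA := h ⟨hθI.1, hθI.2.trans hβ₀⟩
    by_cases hhit : θ ∈ hitAngles Ω c d V₀
    · simp only [hA, mem_iUnion] at hθA
      obtain ⟨θ', hl, ⟨V, -, hVp, hVΩ, hVS, hBV, hV, hθV⟩, hlt⟩ := hθA
      have hn : ¬ α ≤ θ' := fun hle ↦ hθ hhit V hθV θ'
        (by rw [uIcc_of_le hθI.1.le]; exact ⟨hle, (mem_Ioi.1 hlt).le⟩) hV
      exact across hVp hVΩ hVS hBV hαΩ hl (not_le.1 hn) hα₀ hθ₀r (Or.inl hV) (Or.inr hqV₀)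
    · exact hAA'.notMem_of_mem_left hθA (mem_biUnion (x := θ₀) hθ₀r
        ⟨⟨V₀, hV₀c, hV₀p, hV₀Ω, hV₀S, hBV₀, hqV₀, hhit⟩, hθI.2⟩)
  · have hev := (eventually_touchPoint_not_mem hd hβΩ hV₀c hV₀Ω).filter_mono
      (nhdsWithin_le_nhds (s := Iio β))
    obtain ⟨θ, hθ, hθI⟩ := (hev.and (Ioo_mem_nhdsLT hβ₀)).exists
    have hθA := h ⟨hα₀.trans hθI.1, hθI.2⟩
    by_cases hhit : θ ∈ hitAngles Ω c d V₀
    · simp only [hA', mem_iUnion] at hθA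
      obtain ⟨θ', hr, ⟨V, -, hVp, hVΩ, hVS, hBV, hV, hθV⟩, hlt⟩ := hθA
      have hn : ¬ θ' ≤ β := fun hle ↦ hθ hhit V hθV θ'
        (by rw [uIcc_of_ge hθI.2.le]; exact ⟨(mem_Iio.1 hlt).le, hle⟩) hV
      exact across hVp hVΩ hVS hBV hβΩ hθ₀l hβ₀ (not_le.1 hn) hr (Or.inr hqV₀) (Or.inl hV)
    · exact hAA'.notMem_of_mem_right hθA (mem_biUnion (x := θ₀) hθ₀l
        ⟨⟨V₀, hV₀c, hV₀p, hV₀Ω, hV₀S, hBV₀, hqV₀, hhit⟩, hθI.1⟩)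

theorem mainTheorem5 (Ω : Set (ℝ × ℝ)) (hΩ_open : IsOpen Ω) (hΩ_sc : IsSimplyConnected Ω)
    (hΩ_bdd : Bornology.IsBounded Ω) (S : Set (ℝ × ℝ)) (hS : IsAxisSquare S) (hSΩ : S ⊆ Ω)
    (hS_touch : (frontier S ∩ frontier Ω).Nonempty)
    (B : ℝ × ℝ) (hB : B ∈ Ω \ closure S) :
    ∃ Q : Set (ℝ × ℝ), IsAxisSquare Q ∧ Q ⊆ Ω \ closure S ∧
      (closure Q ∩ closure S ∩ Ω).Nonempty ∧
      (B ∈ closure Q ∨ LieInDifferentComponents (Ω \ closure Q) S B) := by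
  obtain ⟨c, R, hR, rfl⟩ := hS
  obtain ⟨b, hbS, hbΩ⟩ := hS_touch
  rw [axisSquare_eq_ball] at *
  rw [closure_ball c hR.ne'] at *
  rw [frontier_ball c hR.ne', mem_sphere, dist_eq_norm, ← norm_neg, neg_sub] at hbS
  subst hbS
  have hb : c - (c - b) ∉ Ω := by
    rw [sub_sub_cancel]
    exact fun h ↦ (hΩ_open.frontier_eq ▸ hbΩ).2 h
  obtain ⟨z, r, hr, h1, h2, h3⟩ := exists_separating_ball hΩ_open hΩ_sc hΩ_bdd
    (norm_pos_iff.1 hR) hSΩ hb hB.1 hB.2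
  refine ⟨ball z r, ⟨z, r, hr, (axisSquare_eq_ball z r).symm⟩, h1, ?_⟩
  rw [closure_ball z hr.ne']
  exact ⟨h2, h3⟩
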